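/- Let $d\ge 2$, $m\ge 0$, and let $A:\mathbb{R}^d\to\mathbb{R}^m$ be a linear map whose largest singular value $\sigma_1=\|A\|$ (operator norm for the Euclidean norms) has multiplicity one, i.e. $\dim\{x\in\mathbb{R}^d : A^*Ax=\|A\|^2x\}=1$. Let $v^0$ be a (possibly random) vector in $\mathbb{R}^d$ with $\|v^0\|=1$ almost surely, and let $y^0,y^1,y^2,\dots$ be independent $\mathcal N(0,I_d)$-distributed random vectors that are jointly independent of $v^0$. For $k=0,1,2,\dots$ define $$x^k=\frac{y^k-\langle y^k,v^k\rangle v^k}{\|y^k-\langle y^k,v^k\rangle v^k\|},\qquad a_k=\langle Av^k,Ax^k\rangle,\qquad b_k=\|Ax^k\|^2-\|Av^k\|^2,$$ $$\tau_k=\operatorname{sign}(a_k)\left(\frac{b_k}{2|a_k|}+\sqrt{\frac{b_k^2}{4a_k^2}+1}\right),\qquad v^{k+1}=\frac{v^k+\tau_kx^k}{\sqrt{1+\tau_k^2}},$$ with the convention $\tau_k=0$ (so $v^{k+1}=v^k$) if $a_k=0$. Then almost surely $$\min_{0\le k\le n}|\tau_k|\in\mathcal O(n^{-1/2}),\qquad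 n\to\infty,$$ where the constant in $\mathcal O$ may depend on the realization. -/

import Mathlib

open MeasureTheory ProbabilityTheory Filter

namespace AdjointFree

noncomputable section

/-- The multiplicity of `σ ≥ 0` as a singular value of `A`: the dimension of the space
`{x | A* A x = σ² x}` of right singular vectors. -/
def singMultiplicity {m d : ℕ}
    (A : EuclideanSpace ℝ (Fin d) →L[ℝ] EuclideanSpace ℝ (Fin m)) (σ : ℝ) : ℕ :=
  Module.finrank ℝ
    (Module.End.eigenspace
      ((ContinuousLinearMap.adjoint A ∘L A :
        EuclideanSpace ℝ (Fin d) →L[ℝ] EuclideanSpace ℝ (Fin d)) :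
        EuclideanSpace ℝ (Fin d) →ₗ[ℝ] EuclideanSpace ℝ (Fin d)) (σ ^ 2))

/-- The normalized projection of `y` onto the orthogonal complement of the unit vector `v`. -/
def direction {d : ℕ} (v y : EuclideanSpace ℝ (Fin d)) : EuclideanSpace ℝ (Fin d) :=
  (‖y - inner ℝ y v • v‖)⁻¹ • (y - inner ℝ y v • v)

/-- `a = ⟨A v, A x⟩`. -/
def aCoeff {m d : ℕ} (A : EuclideanSpace ℝ (Fin d) →L[ℝ] EuclideanSpace ℝ (Fin m))
    (v x : EuclideanSpace ℝ (Fin d)) : ℝ :=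
  inner ℝ (A v) (A x)

/-- `b = ‖A x‖² - ‖A v‖²`. -/
def bCoeff {m d : ℕ} (A : EuclideanSpace ℝ (Fin d) →L[ℝ] EuclideanSpace ℝ (Fin m))
    (v x : EuclideanSpace ℝ (Fin d)) : ℝ :=
  ‖A x‖ ^ 2 - ‖A v‖ ^ 2

/-- The exact stepsize `τ = sign(a) (b / (2|a|) + √(b² / (4a²) + 1))`.
For `a = 0` the value is `0`, as `Real.sign 0 = 0`; this is the maximizer of
`τ ↦ ‖A v + τ A x‖² / (1 + τ²)` also for `a = 0` whenever `b < 0`. -/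
def stepsize {m d : ℕ} (A : EuclideanSpace ℝ (Fin d) →L[ℝ] EuclideanSpace ℝ (Fin m))
    (v x : EuclideanSpace ℝ (Fin d)) : ℝ :=
  Real.sign (aCoeff A v x) *
    (bCoeff A v x / (2 * |aCoeff A v x|) +
      √(bCoeff A v x ^ 2 / (4 * aCoeff A v x ^ 2) + 1))

/-- The iterates `v^k` of the algorithm, started at `v₀` and driven by the samples `y^k`:
`v^{k+1} = (v^k + τ_k x^k) / √(1 + τ_k²)`. -/
def iterate {m d : ℕ} (A : EuclideanSpace ℝ (Fin d) →L[ℝ] EuclideanSpace ℝ (Fin m))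
    (v₀ : EuclideanSpace ℝ (Fin d)) (y : ℕ → EuclideanSpace ℝ (Fin d)) :
    ℕ → EuclideanSpace ℝ (Fin d)
  | 0 => v₀
  | k + 1 =>
    let v := iterate A v₀ y k
    let x := direction v (y k)
    let τ := stepsize A v x
    (√(1 + τ ^ 2))⁻¹ • (v + τ • x)

/-- The stepsize `τ_k` computed in step `k` of the algorithm. -/
def tau {m d : ℕ} (A : EuclideanSpace ℝ (Fin d) →L[ℝ] EuclideanSpace ℝ (Fin m))
    (v₀ : EuclideanSpace ℝ (Fin d)) (y : ℕ → EuclideanSpace ℝ (Fin d)) (k : ℕ) : ℝ :=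
  stepsize A (iterate A v₀ y k) (direction (iterate A v₀ y k) (y k))

end

end AdjointFree

/-!
Write `f v = ‖A v‖²`. If some stepsize `τ_k` vanishes, the running minimum is eventually `0`.
Otherwise every step replaces the unit vector `v^k` by the maximizer of `f` among the unit vectors of
the plane spanned by `v^k` and `x^k`, and `f (v^{k+1}) = f (v^k) + a_k τ_k`
(`sq_norm_map_step`).

* The plane contains `y^k`, so `f (v^{k+1}) ≥ f (y^k) / ‖y^k‖²` (`sq_norm_map_le_step`), whatever
  `v^k` is. For `c < ‖A‖²` the cone `{y | c ‖y‖² < ‖A y‖²}` is open and nonempty, hence has positive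
  Gaussian measure, and by independence almost surely some `y^k` hits it
  (`ae_exists_mem_of_isOpen`). From then on `f (v^k) > c`, since `f` is monotone along the iterates.
* As `‖A‖` has multiplicity one, two orthonormal vectors cannot both attain it, and by compactness
  `f v + f x ≤ 2 ‖A‖² - ε` for orthonormal `v, x` (`exists_gap`). With `c` close to `‖A‖²` this makes
  `b_k = f (x^k) - f (v^k)` at most `-δ < 0` for all large `k`.
* The quadratic equation `a τ² = b τ + a` of the stepsize gives `a τ = τ² (a τ - b) ≥ δ τ²`, so that
  `δ ∑ τ_k² ≤ ‖A‖²` over all large `k` by telescoping, and the minimum of `τ_k²` over `k ≤ n` is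
  `O(1 / n)` (`isBigO_inf'_of_mul_sq_le_sub`).
-/

open scoped InnerProductSpace

namespace AdjointFree

variable {m d : ℕ} {A : EuclideanSpace ℝ (Fin d) →L[ℝ] EuclideanSpace ℝ (Fin m)}
  {v x y : EuclideanSpace ℝ (Fin d)}

/-! ### The exact stepsize -/

lemma add_sqrt_sq_add_one_pos (c : ℝ) : 0 < c + √(c ^ 2 + 1) := by
  have h : |c| < √(c ^ 2 + 1) := by
    rw [← Real.sqrt_sq_eq_abs]
    exact Real.sqrt_lt_sqrt (sq_nonneg c) (by linarith)
  linarith [neg_abs_le c]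

lemma stepsize_eq_zero_of_aCoeff (h : aCoeff A v x = 0) : stepsize A v x = 0 := by
  simp [stepsize, h]

lemma aCoeff_ne_zero_of_stepsize (h : stepsize A v x ≠ 0) : aCoeff A v x ≠ 0 :=
  fun h0 => h (stepsize_eq_zero_of_aCoeff h0)

lemma stepsize_eq_sign_mul (A : EuclideanSpace ℝ (Fin d) →L[ℝ] EuclideanSpace ℝ (Fin m))
    (v x : EuclideanSpace ℝ (Fin d)) :
    stepsize A v x = Real.sign (aCoeff A v x) * (bCoeff A v x / (2 * |aCoeff A v x|) +
      √((bCoeff A v x / (2 * |aCoeff A v x|)) ^ 2 + 1)) := by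
  rw [stepsize, div_pow, mul_pow, sq_abs]
  norm_num

lemma aCoeff_mul_stepsize_pos (ha : aCoeff A v x ≠ 0) :
    0 < aCoeff A v x * stepsize A v x := by
  have ht := add_sqrt_sq_add_one_pos (bCoeff A v x / (2 * |aCoeff A v x|))
  rw [stepsize_eq_sign_mul, ← mul_assoc, mul_comm (aCoeff A v x)]
  exact mul_pos (Real.sign_mul_pos_of_ne_zero _ ha) ht

/-- The critical point equation of `τ ↦ ‖A v + τ A x‖² / (1 + τ²)`. -/
lemma aCoeff_mul_stepsize_sq (ha : aCoeff A v x ≠ 0) :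
    aCoeff A v x * stepsize A v x ^ 2 =
      bCoeff A v x * stepsize A v x + aCoeff A v x := by
  set a := aCoeff A v x with ha'
  set b := bCoeff A v x with hb'
  set c := b / (2 * |a|) with hc
  have hb : b = 2 * |a| * c := by
    have := abs_pos.2 ha
    rw [hc]; field_simp
  have hs : √(c ^ 2 + 1) ^ 2 = c ^ 2 + 1 := Real.sq_sqrt (by positivity)
  rw [stepsize_eq_sign_mul, ← ha', ← hb', ← hc, hb]
  rcases lt_or_gt_of_ne ha with h | h
  · rw [Real.sign_of_neg h, abs_of_neg h]
    linear_combination a * hs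
  · rw [Real.sign_of_pos h, abs_of_pos h]
    linear_combination a * hs

/-! ### One step of the iteration -/

/-- The unit vector `(v + τ x) / √(1 + τ²)` that replaces `v` in a step along `x`. -/
noncomputable def step (A : EuclideanSpace ℝ (Fin d) →L[ℝ] EuclideanSpace ℝ (Fin m))
    (v x : EuclideanSpace ℝ (Fin d)) : EuclideanSpace ℝ (Fin d) :=
  (√(1 + stepsize A v x ^ 2))⁻¹ • (v + stepsize A v x • x)

lemma iterate_succ (v₀ : EuclideanSpace ℝ (Fin d)) (y : ℕ → EuclideanSpace ℝ (Fin d)) (k : ℕ) :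
    iterate A v₀ y (k + 1) = step A (iterate A v₀ y k) (direction (iterate A v₀ y k) (y k)) :=
  rfl

lemma inner_direction (hv : ‖v‖ = 1) (y : EuclideanSpace ℝ (Fin d)) :
    ⟪v, direction v y⟫_ℝ = 0 := by
  rw [direction, inner_smul_right, inner_sub_right, inner_smul_right, real_inner_self_eq_norm_sq,
    hv, real_inner_comm]
  simp

lemma norm_direction (h : direction v y ≠ 0) : ‖direction v y‖ = 1 := by
  rw [direction] at h ⊢
  have h' : ‖y - ⟪y, v⟫_ℝ • v‖ ≠ 0 := fun h0 => h (by rw [h0]; simp)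
  rw [norm_smul, norm_inv, norm_norm, inv_mul_cancel₀ h']

lemma eq_add_smul_direction (v y : EuclideanSpace ℝ (Fin d)) :
    y = ⟪y, v⟫_ℝ • v + ‖y - ⟪y, v⟫_ℝ • v‖ • direction v y := by
  rcases eq_or_ne (y - ⟪y, v⟫_ℝ • v) 0 with h | h
  · rw [h, norm_zero, zero_smul, add_zero]
    exact sub_eq_zero.1 h
  · rw [direction, smul_smul, mul_inv_cancel₀ (norm_ne_zero_iff.2 h), one_smul, add_sub_cancel]

lemma ne_zero_of_aCoeff (ha : aCoeff A v x ≠ 0) : x ≠ 0 := by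
  rintro rfl
  simp [aCoeff] at ha

lemma sq_norm_map_add (A : EuclideanSpace ℝ (Fin d) →L[ℝ] EuclideanSpace ℝ (Fin m))
    (v x : EuclideanSpace ℝ (Fin d)) (s t : ℝ) :
    ‖A (s • v + t • x)‖ ^ 2 =
      s ^ 2 * ‖A v‖ ^ 2 + 2 * s * t * aCoeff A v x + t ^ 2 * ‖A x‖ ^ 2 := by
  rw [map_add, map_smul, map_smul, norm_add_sq_real, inner_smul_left, inner_smul_right, norm_smul,
    norm_smul, mul_pow, mul_pow, Real.norm_eq_abs, Real.norm_eq_abs, sq_abs, sq_abs, aCoeff]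
  simp only [conj_trivial]
  ring

lemma sq_norm_add_of_orthonormal (hv : ‖v‖ = 1) (hx : ‖x‖ = 1) (hvx : ⟪v, x⟫_ℝ = 0) (s t : ℝ) :
    ‖s • v + t • x‖ ^ 2 = s ^ 2 + t ^ 2 := by
  rw [norm_add_sq_real, inner_smul_left, inner_smul_right, hvx, norm_smul, norm_smul, hv, hx]
  simp

lemma norm_step (hv : ‖v‖ = 1) (y : EuclideanSpace ℝ (Fin d)) :
    ‖step A v (direction v y)‖ = 1 := by
  rcases eq_or_ne (aCoeff A v (direction v y)) 0 with ha | ha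
  · simp [step, stepsize_eq_zero_of_aCoeff ha, hv]
  · have h := sq_norm_add_of_orthonormal hv (norm_direction (ne_zero_of_aCoeff ha))
      (inner_direction hv y) 1 (stepsize A v (direction v y))
    rw [one_smul, one_pow] at h
    rw [step, ← h, Real.sqrt_sq (norm_nonneg _), norm_smul, norm_inv, norm_norm, inv_mul_cancel₀]
    intro h0
    rw [h0] at h
    nlinarith [sq_nonneg (stepsize A v (direction v y))]

lemma norm_iterate {v₀ : EuclideanSpace ℝ (Fin d)} (hv₀ : ‖v₀‖ = 1)
    (y : ℕ → EuclideanSpace ℝ (Fin d)) (k : ℕ) : ‖iterate A v₀ y k‖ = 1 := by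
  induction k with
  | zero => exact hv₀
  | succ k ih => rw [iterate_succ]; exact norm_step ih (y k)

lemma sq_norm_map_step (ha : aCoeff A v x ≠ 0) :
    ‖A (step A v x)‖ ^ 2 = ‖A v‖ ^ 2 + aCoeff A v x * stepsize A v x := by
  have hq := aCoeff_mul_stepsize_sq ha
  have h := sq_norm_map_add A v x 1 (stepsize A v x)
  rw [one_smul] at h
  have hpos : 0 < 1 + stepsize A v x ^ 2 := by positivity
  rw [step, map_smul, norm_smul, mul_pow, norm_inv, inv_pow, Real.norm_eq_abs, sq_abs,
    Real.sq_sqrt hpos.le, h, inv_mul_eq_iff_eq_mul₀ hpos.ne']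
  rw [bCoeff] at hq
  linear_combination -stepsize A v x * hq

/-- The value `‖A v‖² + a τ` reached by the exact stepsize is the maximum of the Rayleigh quotient
over the plane spanned by `v` and `x`. -/
lemma sq_norm_map_add_le (ha : aCoeff A v x ≠ 0) (s t : ℝ) :
    ‖A (s • v + t • x)‖ ^ 2 ≤
      (‖A v‖ ^ 2 + aCoeff A v x * stepsize A v x) * (s ^ 2 + t ^ 2) := by
  have hq := aCoeff_mul_stepsize_sq ha
  have hp := aCoeff_mul_stepsize_pos ha
  have hτ : stepsize A v x ≠ 0 := fun h => by simp [h] at hp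
  rw [sq_norm_map_add]
  set a := aCoeff A v x
  set τ := stepsize A v x
  -- The difference of the two sides is a square with the positive weight `a τ`.
  have key : (‖A v‖ ^ 2 + a * τ) * (s ^ 2 + t ^ 2) -
      (s ^ 2 * ‖A v‖ ^ 2 + 2 * s * t * a + t ^ 2 * ‖A x‖ ^ 2) = a * τ * (s - t / τ) ^ 2 := by
    rw [bCoeff] at hq
    field_simp
    linear_combination t ^ 2 * hq
  have : 0 ≤ a * τ * (s - t / τ) ^ 2 := by positivity
  linarith

lemma sq_norm_map_le_step (hv : ‖v‖ = 1) (ha : aCoeff A v (direction v y) ≠ 0) :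
    ‖A y‖ ^ 2 ≤ ‖A (step A v (direction v y))‖ ^ 2 * ‖y‖ ^ 2 := by
  have h := sq_norm_map_add_le ha ⟪y, v⟫_ℝ ‖y - ⟪y, v⟫_ℝ • v‖
  rwa [← sq_norm_map_step ha, ← sq_norm_add_of_orthonormal hv
    (norm_direction (ne_zero_of_aCoeff ha)) (inner_direction hv y),
    ← eq_add_smul_direction] at h

/-- Where `b` is negative and bounded away from `0`, the gain `a τ` of a step controls `τ²`. -/
lemma mul_stepsize_sq_le {δ : ℝ} (ha : aCoeff A v x ≠ 0) (hb : bCoeff A v x ≤ -δ) :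
    δ * stepsize A v x ^ 2 ≤ aCoeff A v x * stepsize A v x := by
  have hq := aCoeff_mul_stepsize_sq ha
  have hp := aCoeff_mul_stepsize_pos ha
  have h : aCoeff A v x * stepsize A v x =
      stepsize A v x ^ 2 * (aCoeff A v x * stepsize A v x - bCoeff A v x) := by
    linear_combination -stepsize A v x * hq
  rw [h, mul_comm]
  exact mul_le_mul_of_nonneg_left (by linarith) (sq_nonneg _)

/-! ### The spectral gap -/

lemma sq_norm_map_le_of_unit (hv : ‖v‖ = 1) : ‖A v‖ ^ 2 ≤ ‖A‖ ^ 2 := by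
  have h := A.le_opNorm v
  rw [hv, mul_one] at h
  gcongr

lemma adjoint_apply_eq_of_norm_eq (hv : ‖v‖ = 1) (h : ‖A v‖ ^ 2 = ‖A‖ ^ 2) :
    ContinuousLinearMap.adjoint A (A v) = ‖A‖ ^ 2 • v := by
  have hle : ‖ContinuousLinearMap.adjoint A (A v)‖ ^ 2 ≤ ‖A‖ ^ 2 * ‖A v‖ ^ 2 := by
    have := (ContinuousLinearMap.adjoint A).le_opNorm (A v)
    rw [LinearIsometryEquiv.norm_map] at this
    rw [← mul_pow]
    gcongr
  have h0 : ‖ContinuousLinearMap.adjoint A (A v) - ‖A‖ ^ 2 • v‖ ^ 2 ≤ 0 := by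
    rw [norm_sub_sq_real, inner_smul_right, ContinuousLinearMap.adjoint_inner_left,
      real_inner_self_eq_norm_sq, norm_smul, hv, mul_one, Real.norm_eq_abs, sq_abs]
    rw [h] at hle ⊢
    nlinarith
  exact sub_eq_zero.1 (norm_eq_zero.1 (pow_eq_zero_iff two_ne_zero |>.1
    (le_antisymm h0 (sq_nonneg _))))

lemma mem_eigenspace_iff_adjoint (μ : ℝ) :
    v ∈ Module.End.eigenspace
      ((ContinuousLinearMap.adjoint A ∘L A :
        EuclideanSpace ℝ (Fin d) →L[ℝ] EuclideanSpace ℝ (Fin d)) :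
        EuclideanSpace ℝ (Fin d) →ₗ[ℝ] EuclideanSpace ℝ (Fin d)) μ ↔
      ContinuousLinearMap.adjoint A (A v) = μ • v := by
  rw [Module.End.mem_eigenspace_iff]
  rfl

lemma exists_unit_norm_map_eq (hA : singMultiplicity A ‖A‖ = 1) :
    ∃ u : EuclideanSpace ℝ (Fin d), ‖u‖ = 1 ∧ ‖A u‖ ^ 2 = ‖A‖ ^ 2 := by
  obtain ⟨⟨w, hw⟩, hw0, -⟩ := finrank_eq_one_iff'.1 hA
  have hw0' : ‖w‖ ≠ 0 := fun h => hw0 (Subtype.ext (norm_eq_zero.1 h))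
  rw [mem_eigenspace_iff_adjoint] at hw
  have hAw : ‖A w‖ ^ 2 = ‖A‖ ^ 2 * ‖w‖ ^ 2 := by
    rw [← real_inner_self_eq_norm_sq, ← ContinuousLinearMap.adjoint_inner_left, hw,
      inner_smul_left, real_inner_self_eq_norm_sq]
    simp
  refine ⟨‖w‖⁻¹ • w, ?_, ?_⟩
  · rw [norm_smul, norm_inv, norm_norm, inv_mul_cancel₀ hw0']
  · rw [map_smul, norm_smul, norm_inv, norm_norm, mul_pow, hAw]
    field_simp

lemma sq_norm_map_add_lt (hA : singMultiplicity A ‖A‖ = 1) (hv : ‖v‖ = 1) (hx : ‖x‖ = 1)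
    (hvx : ⟪v, x⟫_ℝ = 0) : ‖A v‖ ^ 2 + ‖A x‖ ^ 2 < 2 * ‖A‖ ^ 2 := by
  have h1 := sq_norm_map_le_of_unit (A := A) hv
  have h2 := sq_norm_map_le_of_unit (A := A) hx
  by_contra! hcon
  have hv' := (mem_eigenspace_iff_adjoint (‖A‖ ^ 2)).2
    (adjoint_apply_eq_of_norm_eq (A := A) hv (by linarith))
  have hx' := (mem_eigenspace_iff_adjoint (‖A‖ ^ 2)).2
    (adjoint_apply_eq_of_norm_eq (A := A) hx (by linarith))
  obtain ⟨w, -, hw⟩ := finrank_eq_one_iff'.1 hA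
  obtain ⟨s, hs⟩ := hw ⟨v, hv'⟩
  obtain ⟨t, ht⟩ := hw ⟨x, hx'⟩
  have hs' : s • (w : EuclideanSpace ℝ (Fin d)) = v := congrArg Subtype.val hs
  have ht' : t • (w : EuclideanSpace ℝ (Fin d)) = x := congrArg Subtype.val ht
  rw [← hs', ← ht', inner_smul_left, inner_smul_right, real_inner_self_eq_norm_sq] at hvx
  rw [← hs', norm_smul] at hv
  rw [← ht', norm_smul] at hx
  simp only [conj_trivial, mul_eq_zero, pow_eq_zero_iff, ne_eq, OfNat.ofNat_ne_zero,
    not_false_eq_true] at hvx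
  rcases hvx with h | h | h <;> simp [h] at hv hx

lemma exists_gap (hA : singMultiplicity A ‖A‖ = 1) :
    ∃ ε > 0, ∀ v x : EuclideanSpace ℝ (Fin d), ‖v‖ = 1 → ‖x‖ = 1 → ⟪v, x⟫_ℝ = 0 →
      ‖A v‖ ^ 2 + ‖A x‖ ^ 2 ≤ 2 * ‖A‖ ^ 2 - ε := by
  let K : Set (EuclideanSpace ℝ (Fin d) × EuclideanSpace ℝ (Fin d)) :=
    (Metric.sphere 0 1 ×ˢ Metric.sphere 0 1) ∩ {p | ⟪p.1, p.2⟫_ℝ = 0}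
  have hK : IsCompact K := ((isCompact_sphere _ _).prod (isCompact_sphere _ _)).inter_right
    (isClosed_eq (by fun_prop) (by fun_prop))
  have hmem : ∀ p, p ∈ K ↔ (‖p.1‖ = 1 ∧ ‖p.2‖ = 1) ∧ ⟪p.1, p.2⟫_ℝ = 0 := fun p => by
    simp [K]
  rcases K.eq_empty_or_nonempty with hE | hE
  · refine ⟨1, one_pos, fun v x hv hx hvx => ?_⟩
    have : (v, x) ∈ K := (hmem _).2 ⟨⟨hv, hx⟩, hvx⟩
    simp [hE] at this
  · obtain ⟨p, hp, hmax⟩ := hK.exists_isMaxOn hE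
      (f := fun p => ‖A p.1‖ ^ 2 + ‖A p.2‖ ^ 2) (by fun_prop)
    obtain ⟨⟨h1, h2⟩, h3⟩ := (hmem p).1 hp
    refine ⟨2 * ‖A‖ ^ 2 - (‖A p.1‖ ^ 2 + ‖A p.2‖ ^ 2),
      sub_pos.2 (sq_norm_map_add_lt hA h1 h2 h3), fun v x hv hx hvx => ?_⟩
    have := hmax ((hmem (v, x)).2 ⟨⟨hv, hx⟩, hvx⟩)
    simp only [Set.mem_ofPred_eq] at this
    linarith

/-! ### Convergence rate along a fixed realization -/

/-- If the weighted squares `δ τ_k²` are eventually dominated by the increments of a sequence with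
values in `[0, B]`, then the running minimum of `|τ_k|` is `O(n^{-1/2})`. -/
lemma isBigO_inf'_of_mul_sq_le_sub {τ f : ℕ → ℝ} {δ B : ℝ} {N : ℕ} (hδ : 0 < δ)
    (hf0 : ∀ k, 0 ≤ f k) (hfB : ∀ k, f k ≤ B)
    (h : ∀ k ≥ N, δ * τ k ^ 2 ≤ f (k + 1) - f k) :
    (fun n : ℕ => (Finset.range (n + 1)).inf' Finset.nonempty_range_add_one (fun k => |τ k|))
      =O[atTop] (fun n : ℕ => (n : ℝ) ^ (-(1 / 2 : ℝ))) := by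
  refine Asymptotics.IsBigO.of_bound √(2 * B / δ) ?_
  filter_upwards [eventually_ge_atTop (2 * N + 1)] with n hn
  set M := (Finset.range (n + 1)).inf' Finset.nonempty_range_add_one (fun k => |τ k|) with hM
  have hM0 : 0 ≤ M := Finset.le_inf' _ _ fun k _ => abs_nonneg _
  have hMle : ∀ k ≤ n, M ≤ |τ k| := fun k hk =>
    Finset.inf'_le (fun k => |τ k|) (Finset.mem_range.2 (by omega))
  have hsum : ∀ j, N + j ≤ n → δ * j * M ^ 2 ≤ f (N + j) - f N := by
    intro j
    induction j with
    | zero => intro _; simp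
    | succ j ih =>
      intro hj
      have h1 := ih (by omega)
      have h2 := h (N + j) (by omega)
      have h3 : M ^ 2 ≤ τ (N + j) ^ 2 := by
        rw [← sq_abs (τ (N + j))]
        exact pow_le_pow_left₀ hM0 (hMle _ (by omega)) 2
      have h4 := mul_le_mul_of_nonneg_left h3 hδ.le
      push_cast
      rw [← add_assoc]
      nlinarith
  have h1 := hsum (n - N) (by omega)
  have hN : N + (n - N) = n := by omega
  rw [hN] at h1
  have hn0 : (0 : ℝ) < n := by
    have : 0 < n := by omega
    exact_mod_cast this
  -- At least half of the indices up to `n` lie beyond `N`.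
  have hhalf : (n : ℝ) / 2 ≤ ((n - N : ℕ) : ℝ) := by
    have : (n : ℝ) ≤ 2 * ((n - N : ℕ) : ℝ) := by
      have : n ≤ 2 * (n - N) := by omega
      exact_mod_cast this
    linarith
  have h2 : δ * (n / 2) * M ^ 2 ≤ B := by
    have h3 : δ * (n / 2) * M ^ 2 ≤ δ * ((n - N : ℕ) : ℝ) * M ^ 2 := by gcongr
    linarith [hf0 N, hfB n]
  have h3 : M ^ 2 ≤ 2 * B / δ * (n : ℝ)⁻¹ := by
    rw [← div_eq_mul_inv, div_div, le_div_iff₀ (by positivity)]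
    linarith
  have hB : 0 ≤ 2 * B / δ := by
    have := (hf0 0).trans (hfB 0)
    positivity
  rw [Real.norm_eq_abs, Real.norm_eq_abs, abs_of_nonneg hM0, abs_of_nonneg (by positivity),
    Real.rpow_neg hn0.le, ← Real.sqrt_eq_rpow, ← Real.sqrt_inv, ← Real.sqrt_mul hB]
  exact Real.le_sqrt_of_sq_le h3

lemma isBigO_inf'_of_eq_zero {τ : ℕ → ℝ} {k : ℕ} (hk : τ k = 0) :
    (fun n : ℕ => (Finset.range (n + 1)).inf' Finset.nonempty_range_add_one (fun k => |τ k|))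
      =O[atTop] (fun n : ℕ => (n : ℝ) ^ (-(1 / 2 : ℝ))) := by
  have h : (fun n : ℕ => (Finset.range (n + 1)).inf' Finset.nonempty_range_add_one
      (fun k => |τ k|)) =ᶠ[atTop] fun _ => (0 : ℝ) := by
    filter_upwards [eventually_ge_atTop k] with n hn
    refine le_antisymm ?_ (Finset.le_inf' _ _ fun k _ => abs_nonneg _)
    have := Finset.inf'_le (fun k => |τ k|) (Finset.mem_range.2 (Nat.lt_succ_of_le hn))
    rwa [hk, abs_zero] at this
  exact h.trans_isBigO (Asymptotics.isBigO_zero _ _)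

/-- The rate holds along every realization in which one sample falls into the cone on which the
Rayleigh quotient of `A* A` is nearly maximal; `ε` is the gap of `exists_gap`. -/
lemma isBigO_inf'_tau {ε : ℝ} (hε : 0 < ε)
    (hgap : ∀ v x : EuclideanSpace ℝ (Fin d), ‖v‖ = 1 → ‖x‖ = 1 → ⟪v, x⟫_ℝ = 0 →
      ‖A v‖ ^ 2 + ‖A x‖ ^ 2 ≤ 2 * ‖A‖ ^ 2 - ε)
    {v₀ : EuclideanSpace ℝ (Fin d)} (hv₀ : ‖v₀‖ = 1) {y : ℕ → EuclideanSpace ℝ (Fin d)}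
    (hy : ∃ k, (‖A‖ ^ 2 - ε / 4) * ‖y k‖ ^ 2 < ‖A (y k)‖ ^ 2) :
    (fun n : ℕ => (Finset.range (n + 1)).inf' Finset.nonempty_range_add_one
        (fun k => |tau A v₀ y k|))
      =O[atTop] (fun n : ℕ => (n : ℝ) ^ (-(1 / 2 : ℝ))) := by
  by_cases h0 : ∃ k, tau A v₀ y k = 0
  · exact isBigO_inf'_of_eq_zero h0.choose_spec
  push Not at h0
  obtain ⟨K, hK⟩ := hy
  let f : ℕ → ℝ := fun k => ‖A (iterate A v₀ y k)‖ ^ 2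
  let X : ℕ → EuclideanSpace ℝ (Fin d) := fun k => direction (iterate A v₀ y k) (y k)
  have hnorm := norm_iterate (A := A) hv₀ y
  have ha : ∀ k, aCoeff A (iterate A v₀ y k) (X k) ≠ 0 := fun k =>
    aCoeff_ne_zero_of_stepsize (h0 k)
  have hstep : ∀ k, f (k + 1) = f k + aCoeff A (iterate A v₀ y k) (X k) * tau A v₀ y k :=
    fun k => sq_norm_map_step (ha k)
  have hmono : Monotone f := monotone_nat_of_le_succ fun k => by
    rw [hstep]
    exact le_add_of_nonneg_right (aCoeff_mul_stepsize_pos (ha k)).le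
  have hlarge : ‖A‖ ^ 2 - ε / 4 < f (K + 1) :=
    lt_of_mul_lt_mul_right (hK.trans_le (sq_norm_map_le_step (hnorm K) (ha K))) (sq_nonneg _)
  refine isBigO_inf'_of_mul_sq_le_sub (f := f) (N := K + 1) (half_pos hε)
    (fun k => sq_nonneg _) (fun k => sq_norm_map_le_of_unit (hnorm k)) fun k hk => ?_
  rw [hstep, add_sub_cancel_left]
  refine mul_stepsize_sq_le (ha k) ?_
  have h1 := hgap _ _ (hnorm k) (norm_direction (ne_zero_of_aCoeff (ha k)))
    (inner_direction (hnorm k) (y k))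
  have h2 : f (K + 1) ≤ f k := hmono hk
  rw [bCoeff]
  simp only [f] at h2 hlarge ⊢
  linarith

/-! ### Gaussian samples -/

instance isOpenPosMeasure_stdGaussian :
    (stdGaussian (EuclideanSpace ℝ (Fin d))).IsOpenPosMeasure := by
  have : (gaussianReal 0 1).IsOpenPosMeasure :=
    (gaussianReal_absolutelyContinuous' 0 one_ne_zero).isOpenPosMeasure
  rw [← map_pi_eq_stdGaussian]
  exact (PiLp.continuous_toLp 2 _).isOpenPosMeasure_map (WithLp.toLp_surjective 2)

/-- Independent samples with a common law of full support almost surely hit a given nonempty open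
set. -/
lemma ae_exists_mem_of_isOpen {Ω E : Type*} [MeasurableSpace Ω] {P : Measure Ω}
    [TopologicalSpace E] [MeasurableSpace E] [BorelSpace E] {μ : Measure E} [IsProbabilityMeasure μ]
    [μ.IsOpenPosMeasure] {y : ℕ → Ω → E} (hy : ∀ k, HasLaw (y k) μ P) (hindep : iIndepFun y P)
    {U : Set E} (hU : IsOpen U) (hUne : U.Nonempty) : ∀ᵐ ω ∂P, ∃ k, y k ω ∈ U := by
  have hlt : μ Uᶜ < 1 := by
    rw [prob_compl_eq_one_sub hU.measurableSet]
    exact ENNReal.sub_lt_self ENNReal.one_ne_top one_ne_zero (hU.measure_pos μ hUne).ne'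
  have hbound : ∀ n : ℕ, P {ω | ¬ ∃ k, y k ω ∈ U} ≤ μ Uᶜ ^ n := by
    intro n
    calc P {ω | ¬ ∃ k, y k ω ∈ U}
        ≤ P (⋂ k ∈ Finset.range n, y k ⁻¹' Uᶜ) := by
          refine measure_mono fun ω hω => ?_
          simp only [Set.mem_iInter]
          exact fun k _ hk => hω ⟨k, hk⟩
      _ = ∏ k ∈ Finset.range n, P (y k ⁻¹' Uᶜ) :=
          hindep.measure_inter_preimage_eq_mul _ fun k _ => hU.measurableSet.compl
      _ = μ Uᶜ ^ n := by
          have h : ∀ k, P (y k ⁻¹' Uᶜ) = μ Uᶜ := fun k =>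
            (hy k).measure_eq (p := fun z => z ∈ Uᶜ) hU.measurableSet.compl
          rw [Finset.prod_congr rfl fun k _ => h k, Finset.prod_const, Finset.card_range]
  exact le_antisymm (ge_of_tendsto' (ENNReal.tendsto_pow_atTop_nhds_zero_of_lt_one hlt) hbound)
    zero_le

end AdjointFree

theorem mainTheorem4 {m d : ℕ} (hd : 2 ≤ d)
    (A : EuclideanSpace ℝ (Fin d) →L[ℝ] EuclideanSpace ℝ (Fin m))
    (hA : AdjointFree.singMultiplicity A ‖A‖ = 1)
    {Ω : Type*} [MeasurableSpace Ω] (P : Measure Ω) [IsProbabilityMeasure P]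
    (v₀ : Ω → EuclideanSpace ℝ (Fin d)) (hv₀ : AEMeasurable v₀ P)
    (hv₀_unit : ∀ᵐ ω ∂P, ‖v₀ ω‖ = 1)
    (y : ℕ → Ω → EuclideanSpace ℝ (Fin d))
    (hy : ∀ k, HasLaw (y k) (stdGaussian (EuclideanSpace ℝ (Fin d))) P)
    (hy_indep : iIndepFun y P)
    (hv₀_indep : IndepFun v₀ (fun ω k => y k ω) P) :
    ∀ᵐ ω ∂P,
      (fun n : ℕ => (Finset.range (n + 1)).inf' Finset.nonempty_range_add_one
          (fun k => |AdjointFree.tau A (v₀ ω) (fun j => y j ω) k|))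
        =O[atTop] (fun n : ℕ => (n : ℝ) ^ (-(1 / 2 : ℝ))) := by
  obtain ⟨ε, hε, hgap⟩ := AdjointFree.exists_gap hA
  have hopen : IsOpen {z : EuclideanSpace ℝ (Fin d) |
      (‖A‖ ^ 2 - ε / 4) * ‖z‖ ^ 2 < ‖A z‖ ^ 2} :=
    isOpen_lt (by fun_prop) (by fun_prop)
  have hne : {z : EuclideanSpace ℝ (Fin d) |
      (‖A‖ ^ 2 - ε / 4) * ‖z‖ ^ 2 < ‖A z‖ ^ 2}.Nonempty := by
    obtain ⟨u, hu, hAu⟩ := AdjointFree.exists_unit_norm_map_eq hA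
    refine ⟨u, ?_⟩
    rw [Set.mem_ofPred_eq, hu, hAu]
    linarith
  filter_upwards [hv₀_unit, AdjointFree.ae_exists_mem_of_isOpen hy hy_indep hopen hne]
    with ω hω hyω
  exact AdjointFree.isBigO_inf'_tau hε hgap hω hyω
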